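/- Let $d>2$, $T>0$, and regard functions on the torus $\mathbb T^d=\mathbb R^d/\mathbb Z^d$ as $\mathbb Z^d$-periodic functions on $\mathbb R^d$. Let $m_0\in C^\infty(\mathbb T^d)$ with $m_0\ge 0$ and $\int_{\mathbb T^d}m_0\,dx=1$. Let $\beta_0\ge 1$, $\theta>1$, $\frac d2<p<\infty$, $\frac1p+\frac1q=1$, $r=\frac1\kappa$ with $$\kappa=\frac{d+2q-dq}{q[(\theta-1)d+2]},\qquad \beta_n=\theta^n\beta_0,\qquad r_n=r\,\frac{\theta^n-1}{\theta-1}\qquad(n\in\mathbb N=\{0,1,2,\dots\}).$$ Then for every $K\ge 0$ and every $n\in\mathbb N$ there is a constant $C\ge0$, depending only on $d,T,m_0,\beta_0,\theta,p,n,K$, such that the following holds. Let $H:\mathbb T^d\times\mathbb R^d\to\mathbb R$ be smooth, let $g:[0,\infty)\to\mathbb R$ be nonnegative and nondecreasing (for instance $g(m)=m^\alpha$ with $\alpha>0$), let $\eta\in C_c^\infty(\mathbb R^d)$ be a symmetric mollifying kernel ($\eta\ge0$, $\eta(-x)=\eta(x)$, $\eta=0$ outside the closed unit ball, $\int\eta=1$),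 put $\eta_\epsilon(x)=\epsilon^{-d}\eta(x/\epsilon)$ and $g_\epsilon(m)=\eta_\epsilon*g(\eta_\epsilon*m)$ for $\epsilon>0$, and $g_0=g$. Let $\epsilon\ge0$ and let $(u^\epsilon,m^\epsilon)$ be a classical solution on $\mathbb T^d\times[0,T]$ of $$\begin{cases}-u^\epsilon_t+H(x,Du^\epsilon)=\Delta u^\epsilon+g_\epsilon(m^\epsilon),\\ m^\epsilon_t-\operatorname{div}(D_pH(x,Du^\epsilon)\,m^\epsilon)=\Delta m^\epsilon,\end{cases}\qquad m^\epsilon(\cdot,0)=m_0,$$ that is, $u^\epsilon,m^\epsilon$ are continuous on $\mathbb T^d\times[0,T]$, their derivatives $\partial_t$, $D$, $D^2$ exist and are continuous on $\mathbb T^d\times(0,T)$, and the equations hold there. If $\|m^\epsilon\|_{L^\infty(0,T;L^{\beta_0}(\mathbb T^d))}\le K$, then for every $\tau\in[0,T]$ $$\int_{\mathbb T^d}(m^\epsilon)^{\beta_n}(\tau,x)\,dx\le C+C\,\Big\|\,|D_pH(x,Du^\epsilon)|^2\Big\|_{L^r(0,T;L^p(\mathbb T^d))}^{r_n},$$ where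 the norm on the right may be $+\infty$ (and $a^0=1$ for all $a\in[0,\infty]$). -/

import Mathlib

open MeasureTheory Set
open scoped ENNReal NNReal ContDiff Gradient Laplacian

namespace MFG

/-- `ℝ^d` with the Euclidean norm. Functions on the torus `𝕋^d = ℝ^d / ℤ^d` are the
`ℤ^d`-periodic functions on `ℝ^d`. -/
abbrev E (d : ℕ) : Type := EuclideanSpace ℝ (Fin d)

/-- `f` is `ℤ^d`-periodic. -/
def IsPeriodic {d : ℕ} {α : Type*} (f : E d → α) : Prop :=
  ∀ (x : E d) (i : Fin d), f (x + EuclideanSpace.single i (1 : ℝ)) = f x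

/-- The unit cell `[0,1)^d`. -/
def cell (d : ℕ) : Set (E d) := {x | ∀ i, x i ∈ Ico (0 : ℝ) 1}

/-- Lebesgue measure on the torus, as Lebesgue measure on the unit cell. -/
noncomputable def torusMeasure (d : ℕ) : Measure (E d) := volume.restrict (cell d)

/-- The norm of `L^a(0,T; L^b(𝕋^d))`, with values in `[0,∞]`. -/
noncomputable def mixedNorm {d : ℕ} (a b : ℝ≥0∞) (T : ℝ) (f : ℝ → E d → ℝ) : ℝ≥0∞ :=
  eLpNorm (fun t => eLpNorm (f t) b (torusMeasure d)) a (volume.restrict (Ioo 0 T))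

/-- The divergence of a vector field. -/
noncomputable def divergence {d : ℕ} (F : E d → E d) (x : E d) : ℝ :=
  ∑ i, (fderiv ℝ F x (EuclideanSpace.single i (1 : ℝ))) i

/-- The gradient `D_p H(x, p)` in the second variable. -/
noncomputable def DpH {d : ℕ} (H : E d → E d → ℝ) (x p : E d) : E d := gradient (H x) p

/-- A smooth Hamiltonian `𝕋^d × ℝ^d → ℝ`. -/
structure IsHamiltonian {d : ℕ} (H : E d → E d → ℝ) : Prop where
  periodic : IsPeriodic H
  smooth : ContDiff ℝ ∞ (Function.uncurry H)

/-- A coupling `g : [0,∞) → ℝ`, nonnegative and nondecreasing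
(the values of `g` off `[0,∞)` are irrelevant). -/
structure IsCoupling (g : ℝ → ℝ) : Prop where
  nonneg : ∀ z, 0 ≤ z → 0 ≤ g z
  mono : MonotoneOn g (Ici 0)

/-- A smooth probability density on the torus. -/
structure IsInitialDensity {d : ℕ} (m₀ : E d → ℝ) : Prop where
  periodic : IsPeriodic m₀
  smooth : ContDiff ℝ ∞ m₀
  nonneg : ∀ x, 0 ≤ m₀ x
  integral_eq_one : ∫ x, m₀ x ∂(torusMeasure d) = 1

/-- A standard symmetric mollifying kernel. -/
structure IsMollifier {d : ℕ} (η : E d → ℝ) : Prop where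
  smooth : ContDiff ℝ ∞ η
  support : ∀ x, 1 < ‖x‖ → η x = 0
  nonneg : ∀ x, 0 ≤ η x
  symm : ∀ x, η (-x) = η x
  integral_eq_one : ∫ x, η x = 1

/-- The rescaled kernel `η_ε(x) = ε^{-d} η(x / ε)`. -/
noncomputable def rescale {d : ℕ} (η : E d → ℝ) (ε : ℝ) (x : E d) : ℝ :=
  (ε ^ d)⁻¹ * η (ε⁻¹ • x)

/-- The convolution `(η * f)(x) = ∫ η(y) f(x - y) dy`. -/
noncomputable def conv {d : ℕ} (η f : E d → ℝ) : E d → ℝ :=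
  convolution η f (ContinuousLinearMap.lsmul ℝ ℝ) volume

open Classical in
/-- The regularized coupling `g_ε(m) = η_ε * g(η_ε * m)`, with the convention `g_0(m) = g(m)`. -/
noncomputable def regCoupling {d : ℕ} (η : E d → ℝ) (g : ℝ → ℝ) (ε : ℝ) (m : E d → ℝ) : E d → ℝ :=
  if ε = 0 then fun x => g (m x)
  else conv (rescale η ε) (fun x => g (conv (rescale η ε) m x))

/-- Regularity of a classical solution of a parabolic equation on `𝕋^d × [0,T]`: the function is
continuous on `𝕋^d × [0,T]`, with `∂_t f`, `D f`, `D² f` existing and continuous on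
`𝕋^d × (0,T)`. -/
structure IsClassical {d : ℕ} (T : ℝ) (f : ℝ → E d → ℝ) : Prop where
  periodic : ∀ t ∈ Icc 0 T, IsPeriodic (f t)
  cont : ContinuousOn (Function.uncurry f) (Icc 0 T ×ˢ univ)
  diff_time : ∀ t ∈ Ioo 0 T, ∀ x, DifferentiableAt ℝ (fun s => f s x) t
  cont_time : ContinuousOn (fun z : ℝ × E d => deriv (fun s => f s z.2) z.1) (Ioo 0 T ×ˢ univ)
  diff_space : ∀ t ∈ Ioo 0 T, ContDiff ℝ 2 (f t)
  cont_D : ContinuousOn (fun z : ℝ × E d => fderiv ℝ (f z.1) z.2) (Ioo 0 T ×ˢ univ)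
  cont_D2 : ContinuousOn (fun z : ℝ × E d => fderiv ℝ (fderiv ℝ (f z.1)) z.2) (Ioo 0 T ×ˢ univ)

/-- `(u, m)` is a classical solution on `𝕋^d × [0,T]` of
`-u_t + H(x, Du) = Δu + g_ε(m)`, `m_t - div(D_pH(x, Du) m) = Δm`, with `m(·,0) = m₀`.
No terminal condition is imposed on `u`. -/
structure IsSolution {d : ℕ} (T : ℝ) (H : E d → E d → ℝ) (g : ℝ → ℝ) (η : E d → ℝ) (ε : ℝ)
    (m₀ : E d → ℝ) (u m : ℝ → E d → ℝ) : Prop where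
  classical_u : IsClassical T u
  classical_m : IsClassical T m
  hamilton_jacobi : ∀ t ∈ Ioo 0 T, ∀ x,
    -deriv (fun s => u s x) t + H x (∇ (u t) x) = Δ (u t) x + regCoupling η g ε (m t) x
  fokker_planck : ∀ t ∈ Ioo 0 T, ∀ x,
    deriv (fun s => m s x) t - divergence (fun y => m t y • DpH H y (∇ (u t) y)) x = Δ (m t) x
  initial : m 0 = m₀

/-- The function `(t, x) ↦ |D_pH(x, Du(x,t))|²`. -/
noncomputable def driftSq {d : ℕ} (H : E d → E d → ℝ) (u : ℝ → E d → ℝ) (t : ℝ) (x : E d) : ℝ :=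
  ‖DpH H x (∇ (u t) x)‖ ^ 2

/-- `κ = (d + 2q - dq) / (q [(θ - 1) d + 2])`. -/
noncomputable def kappa (d : ℕ) (q θ : ℝ) : ℝ :=
  (d + 2 * q - d * q) / (q * ((θ - 1) * d + 2))

end MFG

/-!
The bound is a Moser-type iteration for the Fokker–Planck equation `m_t = Δm + div(m b)` with drift
`b = D_pH(x, Du)`: each step turns a bound for the `L^β` norms of `m` into one for the `L^{θβ}` norms.

Powers of `m` are replaced by the smoothed powers `⟨m⟩^a = (m² + 1)^{a/2}` (`bracket`), which are
smooth and positive in `m`. They dominate `|m|^a` and are at most a constant times `1 + |m|^a`, and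
the torus has measure one, so nothing is lost, and the sign of `m` is irrelevant.

Put `γ = θβ` and `w = ⟨m⟩^{γ/2}`. Testing the equation with the derivative of `⟨m⟩^γ` gives
`d/dt ∫ w² ≤ -c ∫ |Dw|² + C ∫ |b|² w²` (`integral_bracket_energy_le`). By the Sobolev inequality on
the torus (`exists_sobolev_torus`), `∫ |Dw|² + ∫ w²` controls `‖w‖²_{L^{2*}}`, where
`2* = 2d / (d - 2)`. The exponent `κ` is exactly the one for which Hölder's inequality reads
`∫ h w² ≤ ‖h‖_{L^p} (‖w‖²_{L^{2/θ}})^κ (‖w‖²_{L^{2*}})^{1-κ}`; here `‖w‖²_{L^{2/θ}}` is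
`(∫ ⟨m⟩^β)^θ`. With Young's inequality (`integral_mul_sq_le`), applied for `h = |b|²` and for
`h = 1`, the Sobolev term absorbs everything else, and what remains is
`d/dt ∫ ⟨m⟩^{θβ} ≤ C (∫ ⟨m⟩^β)^θ (1 + ‖|b|²‖_{L^p}^{1/κ})` (`exists_production_le`).

Integrating in time turns a bound `C Y^e` for `∫ ⟨m⟩^β`, with `Y` the maximum of `1` and the mixed
norm of `|b|²`, into a bound `C' Y^{θe + r}` for `∫ ⟨m⟩^{θβ}` (`exists_integral_bracket_le`). Since
`r_{n+1} = θ r_n + r`, induction on `n` concludes (`exists_integral_bracket_iterate_le`). The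
equation holds only at interior times, where derivatives may blow up towards `t = 0` and `t = T`;
continuity of `∫ ⟨m⟩^γ` on the closed interval is all that the integration in time needs.
-/

namespace MFG

open Filter Topology
open scoped Pointwise

/-! ### Integration on the torus -/

section Torus

variable {d : ℕ}

lemma cell_eq_fundamentalDomain (d : ℕ) :
    cell d = ZSpan.fundamentalDomain (EuclideanSpace.basisFun (Fin d) ℝ).toBasis := by
  ext x
  simp [cell, ZSpan.mem_fundamentalDomain]

lemma isAddFundamentalDomain_cell (d : ℕ) :
    IsAddFundamentalDomain
      (Submodule.span ℤ (range (EuclideanSpace.basisFun (Fin d) ℝ).toBasis)).toAddSubgroup (cell d)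
      (volume : Measure (E d)) := by
  rw [cell_eq_fundamentalDomain]
  exact ZSpan.isAddFundamentalDomain' _ _

lemma isBounded_cell (d : ℕ) : Bornology.IsBounded (cell d) := by
  rw [cell_eq_fundamentalDomain]
  exact ZSpan.fundamentalDomain_isBounded _

lemma isCompact_closure_cell (d : ℕ) : IsCompact (closure (cell d)) :=
  (isBounded_cell d).isCompact_closure

lemma measurableSet_cell (d : ℕ) : MeasurableSet (cell d) := by
  rw [cell_eq_fundamentalDomain]
  exact ZSpan.fundamentalDomain_measurableSet _

lemma volume_cell (d : ℕ) : volume (cell d) = 1 := by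
  have h : cell d = WithLp.ofLp ⁻¹' (univ.pi fun _ : Fin d => Ico (0 : ℝ) 1) := by
    ext x; simp [cell]
  rw [h, (PiLp.volume_preserving_ofLp (Fin d)).measure_preimage
    (MeasurableSet.univ_pi fun _ => measurableSet_Ico).nullMeasurableSet, volume_pi_pi]
  simp

instance isProbabilityMeasure_torusMeasure (d : ℕ) : IsProbabilityMeasure (torusMeasure d) :=
  ⟨by rw [torusMeasure, Measure.restrict_apply_univ, volume_cell]⟩

lemma ae_torusMeasure_of_closure {P : E d → Prop} (h : ∀ x ∈ closure (cell d), P x) :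
    ∀ᵐ x ∂torusMeasure d, P x :=
  (ae_restrict_mem (measurableSet_cell d)).mono fun x hx => h x (subset_closure hx)

lemma integrable_torus {F : Type*} [NormedAddCommGroup F] {f : E d → F} (hf : Continuous f) :
    Integrable f (torusMeasure d) :=
  ((hf.continuousOn.integrableOn_compact (isCompact_closure_cell d)).mono_set subset_closure)

lemma IsPeriodic.add_span {α : Type*} {f : E d → α} (hf : IsPeriodic f)
    {v : E d} (hv : v ∈ Submodule.span ℤ (range (EuclideanSpace.basisFun (Fin d) ℝ).toBasis))
    (x : E d) : f (x + v) = f x := by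
  induction hv using Submodule.span_induction generalizing x with
  | mem v hv =>
    obtain ⟨i, rfl⟩ := hv
    simpa using hf x i
  | zero => simp
  | add v w _ _ h1 h2 => rw [← add_assoc, h2, h1]
  | smul a v _ h =>
    induction a using Int.induction_on generalizing x with
    | zero => simp
    | succ n ih => rw [add_smul, one_smul, ← add_assoc, h, ih]
    | pred n ih =>
      rw [← h, sub_smul, one_smul, add_assoc, sub_add_cancel, ih]

instance countable_lattice (d : ℕ) : Countable
    (Submodule.span ℤ (range (EuclideanSpace.basisFun (Fin d) ℝ).toBasis)).toAddSubgroup :=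
  inferInstanceAs <| Countable
    (Submodule.span ℤ (range (EuclideanSpace.basisFun (Fin d) ℝ).toBasis))

lemma isAddFundamentalDomain_translate (d : ℕ) (v : E d) :
    IsAddFundamentalDomain
      (Submodule.span ℤ (range (EuclideanSpace.basisFun (Fin d) ℝ).toBasis)).toAddSubgroup
      (v +ᵥ cell d) (volume : Measure (E d)) :=
  (isAddFundamentalDomain_cell d).vadd_of_comm v

/-- The integral of a periodic function over any translate of the unit cell is the same. -/
lemma IsPeriodic.lintegral_translate {f : E d → ℝ≥0∞} (hf : IsPeriodic f) (v : E d) :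
    ∫⁻ x in v +ᵥ cell d, f x = ∫⁻ x, f x ∂torusMeasure d :=
  (isAddFundamentalDomain_translate d v).setLIntegral_eq (isAddFundamentalDomain_cell d) f
    fun g x => by
      rw [AddSubgroup.vadd_def, vadd_eq_add, add_comm]; exact hf.add_span g.2 x

lemma IsPeriodic.integral_add {f : E d → ℝ} (hf : IsPeriodic f) (v : E d) :
    ∫ x, f (x + v) ∂torusMeasure d = ∫ x, f x ∂torusMeasure d := by
  have h : ∫ x in v +ᵥ cell d, f x = ∫ x, f x ∂torusMeasure d :=
    (isAddFundamentalDomain_translate d v).setIntegral_eq (isAddFundamentalDomain_cell d)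
      fun g x => by
        rw [AddSubgroup.vadd_def, vadd_eq_add, add_comm]; exact hf.add_span g.2 x
  have hp : MeasurePreserving (fun x : E d => x + v) volume volume :=
    measurePreserving_add_right volume v
  rw [← h, ← hp.setIntegral_preimage_emb (measurableEmbedding_addRight v) f, torusMeasure]
  congr 2
  ext x
  simp [mem_vadd_set_iff_neg_vadd_mem, add_comm]

/-- Differentiation under the integral over the torus. -/
lemma hasDerivAt_integral_torus {a b t : ℝ} (ht : t ∈ Ioo a b) {f f' : ℝ → E d → ℝ}
    (hf : ∀ s ∈ Ioo a b, Continuous (f s))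
    (hf' : ContinuousOn (Function.uncurry f') (Ioo a b ×ˢ univ))
    (hd : ∀ s ∈ Ioo a b, ∀ x, HasDerivAt (fun s => f s x) (f' s x) s) :
    HasDerivAt (fun s => ∫ x, f s x ∂torusMeasure d) (∫ x, f' t x ∂torusMeasure d) t := by
  obtain ⟨c, e, hce, hmem, hsub⟩ : ∃ c e, t ∈ Icc c e ∧ Icc c e ∈ 𝓝 t ∧ Icc c e ⊆ Ioo a b := by
    refine ⟨(a + t) / 2, (t + b) / 2, ⟨?_, ?_⟩, Icc_mem_nhds ?_ ?_, fun x hx => ⟨?_, ?_⟩⟩ <;>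
      first | linarith [ht.1, ht.2] | linarith [ht.1, ht.2, hx.1, hx.2]
  obtain ⟨C, hC⟩ := (isCompact_Icc.prod (isCompact_closure_cell d)).exists_bound_of_continuousOn
    (hf'.mono (prod_mono hsub (subset_univ _)))
  have hcont : ∀ s ∈ Ioo a b, Continuous (f' s) := fun s hs =>
    hf'.comp_continuous (f := fun x => (s, x)) (by fun_prop) fun x => ⟨hs, mem_univ x⟩
  refine (hasDerivAt_integral_of_dominated_loc_of_deriv_le (bound := fun _ => C) hmem ?_
    (integrable_torus (hf t ht)) (hcont t ht).aestronglyMeasurable ?_ (integrable_const C) ?_).2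
  · filter_upwards [hmem] with s hs using (hf s (hsub hs)).aestronglyMeasurable
  · exact ae_torusMeasure_of_closure fun x hx s hs => hC (s, x) ⟨hs, hx⟩
  · exact ae_of_all _ fun x s hs => hd s (hsub hs) x

lemma continuousOn_integral_torus {a b : ℝ} {f : ℝ → E d → ℝ}
    (hf : ContinuousOn (Function.uncurry f) (Icc a b ×ˢ univ)) :
    ContinuousOn (fun s => ∫ x, f s x ∂torusMeasure d) (Icc a b) := by
  obtain ⟨C, hC⟩ := (isCompact_Icc.prod (isCompact_closure_cell d)).exists_bound_of_continuousOn
    (hf.mono (prod_mono subset_rfl (subset_univ _)))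
  refine continuousOn_of_dominated (bound := fun _ => C) (fun s hs => ?_) (fun s hs => ?_)
    (integrable_const C) (ae_of_all _ fun x => ?_)
  · exact (hf.comp_continuous (f := fun x => (s, x)) (by fun_prop)
      fun x => ⟨hs, mem_univ x⟩).aestronglyMeasurable
  · exact ae_torusMeasure_of_closure fun x hx => hC (s, x) ⟨hs, hx⟩
  · exact hf.comp (f := fun s => (s, x)) (by fun_prop) fun s hs => ⟨hs, mem_univ x⟩

/-- The integral of a directional derivative of a periodic function vanishes: it is the derivative
of the integrals of the translates of the function, which are all equal. -/
lemma IsPeriodic.integral_fderiv_eq_zero {f : E d → ℝ} (hf : IsPeriodic f) (hf1 : ContDiff ℝ 1 f)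
    (v : E d) : ∫ x, fderiv ℝ f x v ∂torusMeasure d = 0 := by
  have hc : Continuous (fderiv ℝ f) := hf1.continuous_fderiv one_ne_zero
  have h := hasDerivAt_integral_torus (d := d) (a := -1) (b := 1) (t := 0) (by norm_num)
    (f := fun s x => f (x + s • v)) (f' := fun s x => fderiv ℝ f (x + s • v) v)
    (fun s _ => hf1.continuous.comp (by fun_prop))
    (Continuous.continuousOn (by
      simp only [Function.uncurry_def]
      exact (hc.comp (by fun_prop)).clm_apply continuous_const)) (fun s _ x => ?_)
  · simp only [hf.integral_add, zero_smul, add_zero] at h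
    exact h.unique (hasDerivAt_const _ _)
  · have h1 : HasDerivAt (fun s : ℝ => x + s • v) v s := by
      simpa using ((hasDerivAt_id s).smul_const v).const_add x
    exact ((hf1.differentiable one_ne_zero _).hasFDerivAt.comp_hasDerivAt s h1)

lemma IsPeriodic.comp {α β : Type*} {f : E d → α} (hf : IsPeriodic f) (g : α → β) :
    IsPeriodic fun x => g (f x) := fun x i => congrArg g (hf x i)

lemma IsPeriodic.fderiv {F : Type*} [NormedAddCommGroup F] [NormedSpace ℝ F] {f : E d → F}
    (hf : IsPeriodic f) : IsPeriodic (fderiv ℝ f) := fun x i => by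
  rw [← fderiv_comp_add_right]
  congr 1
  ext y
  exact hf y i

/-- The divergence theorem on the torus. -/
lemma integral_divergence_eq_zero {F : E d → E d} (hF : IsPeriodic F) (hF1 : ContDiff ℝ 1 F) :
    ∫ x, divergence F x ∂torusMeasure d = 0 := by
  have hc : Continuous (_root_.fderiv ℝ F) := hF1.continuous_fderiv one_ne_zero
  have key : ∀ (i : Fin d) x, (_root_.fderiv ℝ F x (EuclideanSpace.single i 1)) i
      = _root_.fderiv ℝ (fun y => F y i) x (EuclideanSpace.single i 1) := fun i x => by
    have h := (EuclideanSpace.proj (𝕜 := ℝ) i).hasFDerivAt.comp x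
      (hF1.differentiable one_ne_zero x).hasFDerivAt
    have h2 := h.fderiv
    rw [show (fun y => F y i) = (EuclideanSpace.proj (𝕜 := ℝ) i) ∘ F
      from rfl, h2]
    rfl
  simp only [divergence]
  rw [integral_finsetSum _ fun i _ => ?_]
  · refine Finset.sum_eq_zero fun i _ => ?_
    simp only [key]
    exact (hF.comp fun y => y i).integral_fderiv_eq_zero (by
      exact (EuclideanSpace.proj (𝕜 := ℝ) i).contDiff.comp hF1) _
  · have h0 : Continuous fun x => _root_.fderiv ℝ F x (EuclideanSpace.single i 1) :=
      hc.clm_apply continuous_const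
    exact integrable_torus (by fun_prop)

lemma eLpNorm_torus {F : Type*} [NormedAddCommGroup F] {f : E d → F} (hf : Continuous f) {s : ℝ}
    (hs : 0 < s) : eLpNorm f (ENNReal.ofReal s) (torusMeasure d) =
      ENNReal.ofReal ((∫ x, ‖f x‖ ^ s ∂torusMeasure d) ^ s⁻¹) := by
  have hmem : MemLp f (ENNReal.ofReal s) (torusMeasure d) := by
    obtain ⟨C, hC⟩ := (isCompact_closure_cell d).exists_bound_of_continuousOn hf.continuousOn
    exact MemLp.of_bound hf.aestronglyMeasurable C (ae_torusMeasure_of_closure hC)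
  rw [hmem.eLpNorm_eq_integral_rpow_norm (by simpa using hs) ENNReal.ofReal_ne_top,
    ENNReal.toReal_ofReal hs.le]

end Torus

/-! ### The Sobolev inequality on the torus -/

section Sobolev

variable {d : ℕ}

lemma exists_translate_cell_mem_nhds (x : E d) : ∃ v : E d, v +ᵥ cell d ∈ 𝓝 x := by
  let c : E d := WithLp.toLp 2 fun _ => 1 / 2
  refine ⟨x - c, ?_⟩
  have ho : IsOpen {y : E d | ∀ i, y i ∈ Ioo (0 : ℝ) 1} := by
    simp only [Set.ofPred_forall]
    exact isOpen_iInter_of_finite fun i => isOpen_Ioo.preimage (by fun_prop)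
  have hc : cell d ∈ 𝓝 c :=
    mem_of_superset (ho.mem_nhds fun i => by norm_num [c]) fun y hy i => Ioo_subset_Ico_self (hy i)
  simpa using vadd_mem_nhds_vadd (x - c) hc

/-- A compact set is covered by finitely many translates of the unit cell, so the integral of a
periodic function over it is controlled by the integral over the torus. -/
lemma exists_setLIntegral_le_of_isCompact {s : Set (E d)} (hs : IsCompact s) :
    ∃ N : ℕ, ∀ h : E d → ℝ≥0∞, IsPeriodic h →
      ∫⁻ x in s, h x ≤ N * ∫⁻ x, h x ∂torusMeasure d := by
  refine hs.induction_on ⟨0, fun h _ => by simp⟩ ?_ ?_ ?_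
  · rintro s t hst ⟨N, hN⟩
    exact ⟨N, fun h hh => (lintegral_mono_set hst).trans (hN h hh)⟩
  · rintro s t ⟨N, hN⟩ ⟨N', hN'⟩
    refine ⟨N + N', fun h hh => (lintegral_union_le h s t).trans ?_⟩
    rw [Nat.cast_add, add_mul]
    exact add_le_add (hN h hh) (hN' h hh)
  · intro x _
    obtain ⟨v, hv⟩ := exists_translate_cell_mem_nhds x
    exact ⟨_, mem_nhdsWithin_of_mem_nhds hv, 1, fun h hh => by simp [hh.lintegral_translate v]⟩

/-- A compactly supported `C¹` function with values in `[-1, 1]` that equals `1` on the unit cell,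
together with a bound for its derivative. -/
lemma exists_cutoff (d : ℕ) : ∃ (χ : E d → ℝ) (M : ℝ), ContDiff ℝ 1 χ ∧ HasCompactSupport χ ∧
    (∀ x ∈ cell d, χ x = 1) ∧ (∀ x, |χ x| ≤ 1) ∧ ∀ x, ‖fderiv ℝ χ x‖ ≤ M := by
  obtain ⟨R, hR⟩ := (isBounded_cell d).subset_closedBall (0 : E d)
  let b : ContDiffBump (0 : E d) := ⟨max R 1, max R 1 + 1, by positivity, by linarith⟩
  obtain ⟨M, hM⟩ := (b.contDiff (n := 1)).continuous_fderiv one_ne_zero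
    |>.bounded_above_of_compact_support (b.hasCompactSupport.fderiv ℝ)
  refine ⟨b, M, b.contDiff, b.hasCompactSupport, fun x hx => ?_, fun x => ?_, hM⟩
  · exact b.one_of_mem_closedBall (Metric.closedBall_subset_closedBall (le_max_left _ _) (hR hx))
  · rw [abs_of_nonneg b.nonneg]; exact b.le_one

/-- The Sobolev inequality `‖f‖²_{L^{2*}} ≤ C (‖Df‖²_{L²} + ‖f‖²_{L²})` on the torus, where
`2* = 2d / (d - 2)`. It follows from the Gagliardo–Nirenberg–Sobolev inequality on `ℝ^d`, applied
to the product of `f` and a cutoff function. -/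
theorem exists_sobolev_torus (hd : 2 < d) : ∃ C : ℝ, 0 < C ∧ ∀ f : E d → ℝ, IsPeriodic f →
    ContDiff ℝ 1 f →
    (∫ x, |f x| ^ (2 * d / (d - 2) : ℝ) ∂torusMeasure d) ^ ((d - 2) / d : ℝ) ≤
      C * ((∫ x, ‖fderiv ℝ f x‖ ^ 2 ∂torusMeasure d) + ∫ x, f x ^ 2 ∂torusMeasure d) := by
  have hd' : (2 : ℝ) < d := by exact_mod_cast hd
  have hd2 : (0 : ℝ) < d - 2 := by linarith
  obtain ⟨χ, M, hχ, hχs, hχ1, hχb, hχM⟩ := exists_cutoff d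
  obtain ⟨N, hN⟩ := exists_setLIntegral_le_of_isCompact (d := d) hχs
  set p' : ℝ≥0 := (2 * d / (d - 2) : ℝ).toNNReal
  have hp'r : (p' : ℝ) = 2 * d / (d - 2) := Real.coe_toNNReal _ (by positivity)
  have hp'0 : 0 < (p' : ℝ) := by rw [hp'r]; positivity
  let G : ℝ≥0 := SNormLESNormFDerivOfEqConst ℝ (volume : Measure (E d)) (2 : ℝ≥0)
  refine ⟨G ^ 2 * (N * (2 + 2 * M ^ 2)) + 1, by positivity, fun f hf hf1 => ?_⟩
  have hfc := hf1.continuous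
  have hfd := hf1.continuous_fderiv one_ne_zero
  set I : ℝ := (∫ x, ‖fderiv ℝ f x‖ ^ 2 ∂torusMeasure d) + ∫ x, f x ^ 2 ∂torusMeasure d
  have hI0 : 0 ≤ I := by positivity
  have hIeq : ∫ x, (‖fderiv ℝ f x‖ ^ 2 + f x ^ 2) ∂torusMeasure d = I :=
    integral_add (integrable_torus (by fun_prop)) (integrable_torus (by fun_prop))
  -- the Gagliardo–Nirenberg–Sobolev inequality for `χ f`
  have hgns := eLpNorm_le_eLpNorm_fderiv_of_eq (F := ℝ) (volume : Measure (E d))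
    (u := fun x => χ x * f x) (hχ.mul hf1) (hχs.mul_right) (p := 2) (p' := p')
    (by norm_num) (by simp; omega) (by
      rw [hp'r, finrank_euclideanSpace_fin]
      push_cast
      field_simp)
  -- its left-hand side dominates the norm of `f` on the cell
  have hleft : ENNReal.ofReal ((∫ x, |f x| ^ (2 * d / (d - 2) : ℝ) ∂torusMeasure d) ^
      ((2 * d / (d - 2) : ℝ)⁻¹)) ≤ eLpNorm (fun x => χ x * f x) p' volume := by
    have h1 : eLpNorm f p' (torusMeasure d) ≤ eLpNorm (fun x => χ x * f x) p' volume := by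
      refine le_trans (le_of_eq ?_)
        (eLpNorm_mono_measure _ (Measure.restrict_le_self (s := cell d)))
      refine eLpNorm_congr_ae ((ae_restrict_mem (measurableSet_cell d)).mono fun x hx => ?_)
      simp [hχ1 x hx]
    refine le_trans (le_of_eq ?_) h1
    exact (eLpNorm_torus hfc (by positivity)).symm
  -- its right-hand side is controlled by finitely many copies of the cell
  have hpt : ∀ x, ‖fderiv ℝ (fun x => χ x * f x) x‖ ^ 2 ≤
      (2 + 2 * M ^ 2) * (‖fderiv ℝ f x‖ ^ 2 + f x ^ 2) := fun x => by
    have h1 : fderiv ℝ (fun x => χ x * f x) x = χ x • fderiv ℝ f x + f x • fderiv ℝ χ x :=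
      fderiv_fun_mul (hχ.differentiable one_ne_zero x) (hf1.differentiable one_ne_zero x)
    have h2 : ‖fderiv ℝ (fun x => χ x * f x) x‖ ≤ ‖fderiv ℝ f x‖ + |f x| * M := by
      rw [h1]
      refine (norm_add_le _ _).trans (add_le_add ?_ ?_)
      · rw [norm_smul, Real.norm_eq_abs]
        exact mul_le_of_le_one_left (norm_nonneg _) (hχb x)
      · rw [norm_smul, Real.norm_eq_abs]
        exact mul_le_mul_of_nonneg_left (hχM x) (abs_nonneg _)
    have h3 := pow_le_pow_left₀ (norm_nonneg _) h2 2
    nlinarith [sq_nonneg (‖fderiv ℝ f x‖ - |f x| * M), sq_abs (f x), sq_nonneg (f x),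
      mul_nonneg (sq_nonneg M) (sq_nonneg ‖fderiv ℝ f x‖)]
  have hright : eLpNorm (fderiv ℝ (fun x => χ x * f x)) (2 : ℝ≥0) volume ^ 2 ≤
      ENNReal.ofReal (N * (2 + 2 * M ^ 2) * I) := by
    have h1 := eLpNorm_nnreal_pow_eq_lintegral (μ := (volume : Measure (E d)))
      (f := fderiv ℝ (fun x => χ x * f x)) (p := 2) (by norm_num)
    simp only [NNReal.coe_ofNat, ENNReal.rpow_ofNat] at h1
    rw [h1]
    have hper : IsPeriodic fun x =>
        ENNReal.ofReal ((2 + 2 * M ^ 2) * (‖fderiv ℝ f x‖ ^ 2 + f x ^ 2)) := fun x i => by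
      simp only [hf x i, hf.fderiv x i]
    calc ∫⁻ x, ‖fderiv ℝ (fun x => χ x * f x) x‖ₑ ^ 2
        = ∫⁻ x in tsupport χ, ‖fderiv ℝ (fun x => χ x * f x) x‖ₑ ^ 2 := by
          refine (setLIntegral_eq_of_support_subset fun x hx => ?_).symm
          by_contra hxs
          have h0 : x ∉ Function.support (fderiv ℝ fun x => χ x * f x) := fun h =>
            hxs (closure_mono (Function.support_mul_subset_left χ f) (support_fderiv_subset ℝ h))
          exact hx (by simp [← ofReal_norm, Function.notMem_support.1 h0])
      _ ≤ ∫⁻ x in tsupport χ,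
            ENNReal.ofReal ((2 + 2 * M ^ 2) * (‖fderiv ℝ f x‖ ^ 2 + f x ^ 2)) := by
          refine lintegral_mono fun x => ?_
          rw [← ofReal_norm, ← ENNReal.ofReal_pow (norm_nonneg _)]
          exact ENNReal.ofReal_le_ofReal (hpt x)
      _ ≤ N * ∫⁻ x, ENNReal.ofReal ((2 + 2 * M ^ 2) * (‖fderiv ℝ f x‖ ^ 2 + f x ^ 2))
            ∂torusMeasure d := hN _ hper
      _ = ENNReal.ofReal (N * (2 + 2 * M ^ 2) * I) := by
          rw [← ofReal_integral_eq_lintegral_ofReal (integrable_torus (by fun_prop))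
            (ae_of_all _ fun x => by positivity), integral_const_mul, hIeq, mul_assoc,
            ENNReal.ofReal_mul (Nat.cast_nonneg N), ENNReal.ofReal_natCast]
  have hfin : ENNReal.ofReal ((∫ x, |f x| ^ (2 * d / (d - 2) : ℝ) ∂torusMeasure d) ^
      ((2 * d / (d - 2) : ℝ)⁻¹)) ^ 2 ≤ ENNReal.ofReal (G ^ 2 * (N * (2 + 2 * M ^ 2) * I)) := by
    refine (pow_le_pow_left' (hleft.trans hgns) 2).trans ?_
    rw [mul_pow, ENNReal.ofReal_mul (by positivity), ENNReal.ofReal_pow (by positivity),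
      ENNReal.ofReal_coe_nnreal]
    exact mul_le_mul_right hright _
  rw [← ENNReal.ofReal_pow (by positivity), ENNReal.ofReal_le_ofReal_iff (by positivity),
    ← Real.rpow_natCast, ← Real.rpow_mul (by positivity)] at hfin
  have he : (2 * d / (d - 2) : ℝ)⁻¹ * (2 : ℕ) = (d - 2) / d := by
    push_cast; field_simp
  rw [he] at hfin
  nlinarith

end Sobolev

/-! ### Interpolation -/

section Interpolation

/-- Hölder's inequality for three factors. -/
lemma integral_rpow_mul_rpow_mul_rpow_le {α : Type*} [MeasurableSpace α] {μ : Measure α}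
    {a b c : α → ℝ} (ha : Integrable a μ) (hb : Integrable b μ) (hc : Integrable c μ)
    (ha0 : 0 ≤ a) (hb0 : 0 ≤ b) (hc0 : 0 ≤ c) {x y z : ℝ} (hx : 0 ≤ x) (hy : 0 ≤ y) (hz : 0 ≤ z)
    (hxyz : x + y + z = 1) :
    ∫ t, a t ^ x * b t ^ y * c t ^ z ∂μ ≤
      (∫ t, a t ∂μ) ^ x * (∫ t, b t ∂μ) ^ y * (∫ t, c t ∂μ) ^ z := by
  have ia := integral_nonneg ha0 (μ := μ)
  have ib := integral_nonneg hb0 (μ := μ)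
  have ic := integral_nonneg hc0 (μ := μ)
  have h := ENNReal.lintegral_prod_norm_pow_le (μ := μ) Finset.univ
    (f := ![fun t => ENNReal.ofReal (a t), fun t => ENNReal.ofReal (b t),
      fun t => ENNReal.ofReal (c t)]) (p := ![x, y, z])
    (by
      intro i _
      fin_cases i
      exacts [ha.aemeasurable.ennreal_ofReal, hb.aemeasurable.ennreal_ofReal,
        hc.aemeasurable.ennreal_ofReal])
    (by simpa [Fin.sum_univ_three] using hxyz)
    (by intro i _; fin_cases i <;> simpa)
  simp only [Fin.prod_univ_three, Matrix.cons_val_zero, Matrix.cons_val_one, Matrix.cons_val] at h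
  rw [← ofReal_integral_eq_lintegral_ofReal ha (ae_of_all _ ha0),
    ← ofReal_integral_eq_lintegral_ofReal hb (ae_of_all _ hb0),
    ← ofReal_integral_eq_lintegral_ofReal hc (ae_of_all _ hc0),
    ENNReal.ofReal_rpow_of_nonneg ia hx, ENNReal.ofReal_rpow_of_nonneg ib hy,
    ENNReal.ofReal_rpow_of_nonneg ic hz, ← ENNReal.ofReal_mul (by positivity),
    ← ENNReal.ofReal_mul (by positivity)] at h
  rw [integral_eq_lintegral_of_nonneg_ae (f := fun t => a t ^ x * b t ^ y * c t ^ z)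
    (ae_of_all _ fun t => by
    have := ha0 t; have := hb0 t; have := hc0 t; simp only [Pi.zero_apply] at *; positivity)
    (((ha.aemeasurable.pow_const x).mul (hb.aemeasurable.pow_const y)).mul
      (hc.aemeasurable.pow_const z)).aestronglyMeasurable]
  refine ENNReal.toReal_le_of_le_ofReal (by positivity) (le_trans (le_of_eq ?_) h)
  refine lintegral_congr fun t => ?_
  have := ha0 t; have := hb0 t; have := hc0 t; simp only [Pi.zero_apply] at *
  rw [ENNReal.ofReal_mul (by positivity), ENNReal.ofReal_mul (by positivity),
    ENNReal.ofReal_rpow_of_nonneg (ha0 t) hx, ENNReal.ofReal_rpow_of_nonneg (hb0 t) hy,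
    ENNReal.ofReal_rpow_of_nonneg (hc0 t) hz]

/-- Young's inequality with a small constant in front of `S`. -/
lemma rpow_mul_rpow_le_add {k μ Z S : ℝ} (hk0 : 0 < k) (hk1 : k < 1) (hμ : 0 < μ) (hZ : 0 ≤ Z)
    (hS : 0 ≤ S) : Z ^ k * S ^ (1 - k) ≤ μ * S + μ ^ (-((1 - k) / k)) * Z := by
  have h := Real.geom_mean_le_arith_mean2_weighted hk0.le (sub_nonneg.2 hk1.le)
    (p₁ := μ ^ (-((1 - k) / k)) * Z) (p₂ := μ * S) (by positivity) (by positivity) (by ring)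
  rw [Real.mul_rpow (by positivity) hZ, Real.mul_rpow hμ.le hS, ← Real.rpow_mul hμ.le,
    show -((1 - k) / k) * k = -(1 - k) by field_simp, Real.rpow_neg hμ.le] at h
  have hne : μ ^ (1 - k) ≠ 0 := by positivity
  have h1 : (μ ^ (1 - k))⁻¹ * Z ^ k * (μ ^ (1 - k) * S ^ (1 - k)) = Z ^ k * S ^ (1 - k) := by
    field_simp
  rw [h1] at h
  refine h.trans ?_
  have h2 : k * (μ ^ (-((1 - k) / k)) * Z) ≤ 1 * (μ ^ (-((1 - k) / k)) * Z) :=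
    mul_le_mul_of_nonneg_right hk1.le (by positivity)
  have h3 : (1 - k) * (μ * S) ≤ 1 * (μ * S) :=
    mul_le_mul_of_nonneg_right (by linarith) (by positivity)
  linarith

variable {d : ℕ} {p q θ : ℝ}

/-- The standing relations between the exponents. -/
lemma exponents_pos (hd : 2 < d) (hp : (d : ℝ) / 2 < p) (hpq : p⁻¹ + q⁻¹ = 1) :
    1 < p ∧ 1 < q ∧ 0 < d + 2 * q - d * q := by
  have hd' : (2 : ℝ) < d := by exact_mod_cast hd
  have hp1 : 1 < p := by linarith
  have hq : 0 < q⁻¹ := by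
    have := inv_lt_one_of_one_lt₀ hp1
    linarith
  have hq0 : 0 < q := inv_pos.1 hq
  have hq1 : 1 < q := by
    have h : q⁻¹ < 1 := by have : 0 < p⁻¹ := by positivity
                           linarith
    exact (inv_lt_one₀ hq0).1 h
  refine ⟨hp1, hq1, ?_⟩
  have hrel : q + p = p * q := by field_simp at hpq; linarith
  -- `p > d / 2` and `q = p / (p - 1)` give `q < d / (d - 2)`
  have h1 : q * (p - 1) = p := by linarith
  have h2 : 0 < (p - 1) * (d + 2 * q - d * q) := by nlinarith
  exact pos_of_mul_pos_right h2 (by linarith)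

lemma kappa_pos (hd : 2 < d) (hp : (d : ℝ) / 2 < p) (hpq : p⁻¹ + q⁻¹ = 1) (hθ : 1 < θ) :
    0 < kappa d q θ := by
  obtain ⟨_, hq1, h⟩ := exponents_pos hd hp hpq
  have : 0 < (θ - 1) * d + 2 := by have : (0 : ℝ) ≤ d := d.cast_nonneg; nlinarith
  unfold kappa; positivity

lemma kappa_lt_one (hd : 2 < d) (hp : (d : ℝ) / 2 < p) (hpq : p⁻¹ + q⁻¹ = 1) (hθ : 1 < θ) :
    kappa d q θ < 1 := by
  obtain ⟨_, hq1, h⟩ := exponents_pos hd hp hpq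
  have hd' : (2 : ℝ) < d := by exact_mod_cast hd
  have h0 : 0 < (θ - 1) * d + 2 := by nlinarith
  rw [kappa, div_lt_one (by positivity)]
  have : 1 < q * θ := by nlinarith
  nlinarith

/-- `κ` is the interpolation parameter that places `L^{2q}` between `L^{2/θ}` and `L^{2*}`. -/
lemma kappa_interpolation (hd : 2 < d) (hp : (d : ℝ) / 2 < p) (hpq : p⁻¹ + q⁻¹ = 1) (hθ : 1 < θ) :
    p⁻¹ + θ * kappa d q θ + (d - 2) / d * (1 - kappa d q θ) = 1 := by
  obtain ⟨hp1, hq1, h⟩ := exponents_pos hd hp hpq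
  have hd' : (2 : ℝ) < d := by exact_mod_cast hd
  have h0 : 0 < (θ - 1) * d + 2 := by nlinarith
  have hq0 : (0 : ℝ) < q := by linarith
  have hp' : p⁻¹ = 1 - q⁻¹ := by linarith
  have hd0 : (0 : ℝ) < d := by linarith
  obtain ⟨D, hD⟩ : ∃ D : ℝ, D = (θ - 1) * d + 2 := ⟨_, rfl⟩
  have hθD : θ = (D - 2) / d + 1 := by rw [hD]; field_simp; ring
  rw [← hD] at h0
  rw [hp', kappa, ← hD, hθD]
  field_simp
  ring

/-- The weighted interpolation inequality
`∫ h w² ≤ μ ‖w‖²_{L^{2*}} + C_μ ‖h‖_{L^p}^{1/κ} ‖w‖²_{L^{2/θ}}` on the torus. -/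
lemma integral_mul_sq_le (hd : 2 < d) (hp : (d : ℝ) / 2 < p) (hpq : p⁻¹ + q⁻¹ = 1) (hθ : 1 < θ)
    {h w : E d → ℝ} (hh : Continuous h) (hh0 : ∀ x, 0 ≤ h x) (hw : Continuous w)
    (hw0 : ∀ x, 0 < w x) {μ : ℝ} (hμ : 0 < μ) :
    ∫ x, h x * w x ^ 2 ∂torusMeasure d ≤
      μ * (∫ x, |w x| ^ (2 * d / (d - 2) : ℝ) ∂torusMeasure d) ^ ((d - 2) / d : ℝ) +
      μ ^ (-((1 - kappa d q θ) / kappa d q θ)) *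
        (((∫ x, h x ^ p ∂torusMeasure d) ^ p⁻¹) ^ (1 / kappa d q θ) *
          (∫ x, w x ^ (2 / θ) ∂torusMeasure d) ^ θ) := by
  obtain ⟨hp1, hq1, -⟩ := exponents_pos hd hp hpq
  have hd' : (2 : ℝ) < d := by exact_mod_cast hd
  have hk0 := kappa_pos hd hp hpq hθ
  have hk1 := kappa_lt_one hd hp hpq hθ
  have hk := kappa_interpolation hd hp hpq hθ
  set k := kappa d q θ
  have hd2 : (0 : ℝ) < d - 2 := by linarith
  have hd0 : (0 : ℝ) < d := by linarith
  have hp0 : (0 : ℝ) < p := by linarith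
  have hk1' : 0 < 1 - k := by linarith
  have hθ0 : 0 < θ := by linarith
  have hA : 0 ≤ ∫ x, w x ^ (2 / θ) ∂torusMeasure d :=
    integral_nonneg fun x => by have := hw0 x; positivity
  have hY : 0 ≤ ∫ x, |w x| ^ (2 * d / (d - 2) : ℝ) ∂torusMeasure d :=
    integral_nonneg fun x => by positivity
  have hN : 0 ≤ ∫ x, h x ^ p ∂torusMeasure d :=
    integral_nonneg fun x => by have := hh0 x; positivity
  have hwr : ∀ a : ℝ, Continuous fun x => w x ^ a := fun a =>
    hw.rpow_const fun x => Or.inl (hw0 x).ne'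
  refine le_trans (le_trans (le_of_eq ?_) (integral_rpow_mul_rpow_mul_rpow_le
    (a := fun x => h x ^ p) (b := fun x => w x ^ (2 / θ))
    (c := fun x => |w x| ^ (2 * d / (d - 2) : ℝ))
    (integrable_torus (hh.rpow_const fun x => Or.inr hp0.le)) (integrable_torus (hwr _))
    (integrable_torus (hw.abs.rpow_const fun x => Or.inr (by positivity)))
    (fun x => by have := hh0 x; simp only [Pi.zero_apply]; positivity)
    (fun x => by have := hw0 x; simp only [Pi.zero_apply]; positivity)
    (fun x => by simp only [Pi.zero_apply]; positivity)
    (by positivity) (by positivity) (by positivity) hk)) ?_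
  · refine integral_congr_ae (ae_of_all _ fun x => ?_)
    have hwx := hw0 x
    have e1 : 2 / θ * (θ * k) + 2 * d / (d - 2) * ((d - 2) / d * (1 - k)) = 2 := by
      field_simp; ring
    simp only []
    rw [abs_of_pos hwx, ← Real.rpow_mul (hh0 x), mul_inv_cancel₀ hp0.ne', Real.rpow_one,
      mul_assoc, ← Real.rpow_mul hwx.le, ← Real.rpow_mul hwx.le, ← Real.rpow_add hwx, e1,
      Real.rpow_two]
  · have hyoung := rpow_mul_rpow_le_add hk0 hk1 hμ
      (Z := ((∫ x, h x ^ p ∂torusMeasure d) ^ p⁻¹) ^ (1 / k) *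
        (∫ x, w x ^ (2 / θ) ∂torusMeasure d) ^ θ)
      (S := (∫ x, |w x| ^ (2 * d / (d - 2) : ℝ) ∂torusMeasure d) ^ ((d - 2) / d : ℝ))
      (by positivity) (by positivity)
    refine le_trans (le_of_eq ?_) hyoung
    rw [Real.mul_rpow (by positivity) (by positivity), ← Real.rpow_mul (by positivity),
      one_div, inv_mul_cancel₀ hk0.ne', Real.rpow_one, ← Real.rpow_mul hA, ← Real.rpow_mul hY]

end Interpolation

/-! ### Smoothed powers -/

section Bracket

/-- The smoothed power `⟨s⟩ᵃ = (s² + 1)^{a/2}`. It is smooth and positive for every real `a`, so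
neither the sign of `s` nor small exponents need special care. -/
noncomputable def bracket (a s : ℝ) : ℝ := (s ^ 2 + 1) ^ (a / 2)

lemma bracket_pos (a s : ℝ) : 0 < bracket a s := by unfold bracket; positivity

lemma bracket_mul (a b s : ℝ) : bracket a s * bracket b s = bracket (a + b) s := by
  rw [bracket, bracket, bracket, ← Real.rpow_add (by positivity), add_div]

lemma bracket_rpow (a b s : ℝ) : bracket a s ^ b = bracket (a * b) s := by
  rw [bracket, bracket, ← Real.rpow_mul (by positivity)]; ring_nf

lemma bracket_sq (a s : ℝ) : bracket a s ^ 2 = bracket (2 * a) s := by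
  rw [sq, bracket_mul, two_mul]

lemma bracket_two (s : ℝ) : bracket 2 s = s ^ 2 + 1 := by simp [bracket]

lemma contDiff_bracket (a : ℝ) {n : WithTop ℕ∞} : ContDiff ℝ n (bracket a) :=
  ContDiff.rpow_const_of_ne (by fun_prop) fun s => by positivity

@[fun_prop]
lemma continuous_bracket (a : ℝ) : Continuous (bracket a) :=
  (contDiff_bracket a (n := 0)).continuous

lemma hasDerivAt_bracket (a s : ℝ) :
    HasDerivAt (bracket a) (a * s * bracket (a - 2) s) s := by
  have h := (((hasDerivAt_id s).pow 2).add_const (1 : ℝ)).rpow_const (p := a / 2)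
    (Or.inl (by simp only [id, Pi.pow_apply]; positivity))
  refine (h.congr_deriv ?_ : HasDerivAt (bracket a) _ s)
  simp only [id, Pi.pow_apply, bracket]
  rw [show (a - 2) / 2 = a / 2 - 1 by ring]
  push_cast
  ring

lemma hasDerivAt_mul_bracket (a s : ℝ) :
    HasDerivAt (fun s => a * s * bracket (a - 2) s)
      (a * bracket (a - 4) s * ((a - 1) * s ^ 2 + 1)) s := by
  have h := ((hasDerivAt_id s).const_mul a).mul (hasDerivAt_bracket (a - 2) s)
  refine (h.congr_deriv ?_ : HasDerivAt (fun s => a * s * bracket (a - 2) s) _ s)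
  have h1 : bracket (a - 2) s = bracket (a - 4) s * (s ^ 2 + 1) := by
    rw [← bracket_two, bracket_mul]; ring_nf
  rw [show a - 2 - 2 = a - 4 by ring, h1]
  simp only [id]
  ring

lemma rpow_abs_le_bracket {a : ℝ} (ha : 0 ≤ a) (s : ℝ) : |s| ^ a ≤ bracket a s := by
  rw [bracket, show a = 2 * (a / 2) by ring, Real.rpow_mul (abs_nonneg _), Real.rpow_two, sq_abs,
    show 2 * (a / 2) = a by ring]
  exact Real.rpow_le_rpow (by positivity) (by linarith) (by positivity)

lemma bracket_le {a : ℝ} (ha : 0 ≤ a) (s : ℝ) : bracket a s ≤ 2 ^ a * (1 + |s| ^ a) := by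
  have h1 : bracket a s ≤ ((2 * max 1 |s|) ^ 2) ^ (a / 2) := by
    refine Real.rpow_le_rpow (by positivity) ?_ (by positivity)
    have h2 : s ^ 2 ≤ max 1 |s| ^ 2 := by
      rw [← sq_abs]; exact pow_le_pow_left₀ (abs_nonneg _) (le_max_right _ _) 2
    have h3 : 1 ≤ max 1 |s| ^ 2 := one_le_pow₀ (le_max_left _ _)
    nlinarith
  refine h1.trans ?_
  rw [← Real.rpow_two, ← Real.rpow_mul (by positivity), show 2 * (a / 2) = a by ring,
    Real.mul_rpow (by positivity) (by positivity)]
  refine mul_le_mul_of_nonneg_left ?_ (by positivity)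
  rcases max_cases 1 |s| with h | h <;> rw [h.1]
  · rw [Real.one_rpow]; have : 0 ≤ |s| ^ a := by positivity
    linarith
  · linarith

/-- The pointwise form of the energy estimate: the quadratic form given by the second derivative
of `⟨s⟩^γ` absorbs the drift term. -/
lemma bracket_energy_pointwise {γ : ℝ} (hγ : 1 < γ) (s v B c : ℝ) (hc : |c| ≤ v * B) :
    -(γ * bracket (γ - 4) s * ((γ - 1) * s ^ 2 + 1) * (v ^ 2 + s * c)) ≤
      -(2 * (γ - 1) / γ) * (γ / 2 * s * bracket (γ / 2 - 2) s * v) ^ 2 +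
        γ ^ 2 / 2 * (B ^ 2 * bracket (γ / 2) s ^ 2) := by
  have hJ := bracket_pos (γ - 4) s
  set J := bracket (γ - 4) s
  have e1 : bracket (γ / 2 - 2) s ^ 2 = J := by rw [bracket_sq]; congr 1; ring
  have e2 : bracket (γ / 2) s ^ 2 = J * (s ^ 2 + 1) ^ 2 := by
    rw [bracket_sq, ← bracket_two, bracket_sq, bracket_mul]; congr 1; ring
  have hγ0 : 0 < γ := by linarith
  rw [e2, show (γ / 2 * s * bracket (γ / 2 - 2) s * v) ^ 2
    = γ ^ 2 / 4 * s ^ 2 * bracket (γ / 2 - 2) s ^ 2 * v ^ 2 by ring, e1]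
  have hP : 0 < (γ - 1) * s ^ 2 + 1 := by nlinarith [sq_nonneg s]
  have hP1 : (γ - 1) * s ^ 2 + 1 ≤ γ * (s ^ 2 + 1) := by nlinarith [sq_nonneg s]
  -- `v² + s·c ≥ v²/2 - s²B²/2`
  have h1 : v ^ 2 / 2 - s ^ 2 * B ^ 2 / 2 ≤ v ^ 2 + s * c := by
    have := mul_le_mul_of_nonneg_left hc (abs_nonneg s)
    rw [← abs_mul] at this
    nlinarith [sq_nonneg (v - |s| * B), sq_abs s, neg_abs_le (s * c)]
  have h2 := mul_le_mul_of_nonneg_left h1 (show 0 ≤ γ * J * ((γ - 1) * s ^ 2 + 1) by positivity)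
  have h3 : (γ - 1) * s ^ 2 * (γ * J * v ^ 2) ≤ ((γ - 1) * s ^ 2 + 1) * (γ * J * v ^ 2) :=
    mul_le_mul_of_nonneg_right (by linarith) (by positivity)
  have h4 : ((γ - 1) * s ^ 2 + 1) * s ^ 2 * (γ * J * B ^ 2)
      ≤ γ * (s ^ 2 + 1) * (s ^ 2 + 1) * (γ * J * B ^ 2) := by
    refine mul_le_mul_of_nonneg_right ?_ (by positivity)
    exact mul_le_mul hP1 (by linarith) (by positivity) (by positivity)
  have e3 : -(2 * (γ - 1) / γ) * (γ ^ 2 / 4 * s ^ 2 * J * v ^ 2)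
      = -((γ - 1) * s ^ 2 * (γ * J * v ^ 2)) / 2 := by field_simp; ring
  rw [e3]
  nlinarith

end Bracket

/-! ### The energy identity -/

section Energy

variable {d : ℕ}

lemma divergence_add {F G : E d → E d} {x : E d} (hF : DifferentiableAt ℝ F x)
    (hG : DifferentiableAt ℝ G x) :
    divergence (fun y => F y + G y) x = divergence F x + divergence G x := by
  simp only [divergence, fderiv_fun_add hF hG, add_apply, PiLp.add_apply,
    Finset.sum_add_distrib]

lemma divergence_smul {a : E d → ℝ} {F : E d → E d} {x : E d} (ha : DifferentiableAt ℝ a x)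
    (hF : DifferentiableAt ℝ F x) :
    divergence (fun y => a y • F y) x = a x * divergence F x + fderiv ℝ a x (F x) := by
  have h : ∑ i, F x i • EuclideanSpace.single i (1 : ℝ) = F x := by
    simpa using (EuclideanSpace.basisFun (Fin d) ℝ).sum_repr (F x)
  have h2 : fderiv ℝ a x (F x)
      = ∑ i, fderiv ℝ a x (EuclideanSpace.single i (1 : ℝ)) * F x i := by
    conv_lhs => rw [← h]
    simp [map_sum, mul_comm]
  rw [h2]
  simp [divergence, fderiv_fun_smul ha hF, Finset.sum_add_distrib, Finset.mul_sum]

lemma contDiff_gradient {f : E d → ℝ} (hf : ContDiff ℝ 2 f) : ContDiff ℝ 1 (∇ f) :=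
  (InnerProductSpace.toDual ℝ (E d)).symm.contDiff.comp
    (hf.fderiv_right (m := 1) (by norm_num))

lemma divergence_gradient {f : E d → ℝ} (hf : ContDiff ℝ 2 f) (x : E d) :
    divergence (∇ f) x = Δ f x := by
  rw [InnerProductSpace.laplacian_eq_iteratedFDeriv_orthonormalBasis f
    (EuclideanSpace.basisFun (Fin d) ℝ)]
  simp only [divergence, iteratedFDeriv_two_apply]
  refine Finset.sum_congr rfl fun i _ => ?_
  have hdf : DifferentiableAt ℝ (fderiv ℝ f) x :=
    (hf.fderiv_right (m := 1) (by norm_num)).differentiable one_ne_zero x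
  have h : fderiv ℝ (∇ f) x (EuclideanSpace.single i 1) =
      (InnerProductSpace.toDual ℝ (E d)).symm (fderiv ℝ (fderiv ℝ f) x
        (EuclideanSpace.single i 1)) := by
    have := ((InnerProductSpace.toDual ℝ
      (E d)).symm.toContinuousLinearEquiv.toContinuousLinearMap.hasFDerivAt.comp x
        hdf.hasFDerivAt).fderiv
    exact congrArg (fun L => L (EuclideanSpace.single i (1 : ℝ))) this
  rw [h]
  have h3 := InnerProductSpace.toDual_symm_apply (𝕜 := ℝ) (x := EuclideanSpace.single i (1 : ℝ))
    (y := fderiv ℝ (fderiv ℝ f) x (EuclideanSpace.single i 1))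
  rw [EuclideanSpace.inner_single_right] at h3
  simpa using h3

lemma IsPeriodic.gradient {f : E d → ℝ} (hf : IsPeriodic f) : IsPeriodic (∇ f) :=
  hf.fderiv.comp _

lemma norm_gradient (f : E d → ℝ) (x : E d) : ‖∇ f x‖ = ‖fderiv ℝ f x‖ := by
  simp [gradient]

/-- Testing the Fokker–Planck operator with `ψ(f)`. -/
lemma integral_mul_laplacian_add_divergence {f : E d → ℝ} (hf : IsPeriodic f)
    (hf2 : ContDiff ℝ 2 f) {b : E d → E d} (hb : IsPeriodic b) (hb1 : ContDiff ℝ 1 b)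
    {ψ ψ' : ℝ → ℝ} (hψ : ContDiff ℝ 1 ψ) (hψ' : ∀ s, HasDerivAt ψ (ψ' s) s)
    (hψc : Continuous ψ') (hint : Continuous (fun x => Δ f x + divergence (fun y => f y • b y) x)) :
    ∫ x, ψ (f x) * (Δ f x + divergence (fun y => f y • b y) x) ∂torusMeasure d =
      ∫ x, -(ψ' (f x) * (‖fderiv ℝ f x‖ ^ 2 + f x * fderiv ℝ f x (b x))) ∂torusMeasure d := by
  have hf1 : ContDiff ℝ 1 f := hf2.of_le (by norm_num)
  have hg := contDiff_gradient hf2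
  have hfb : ContDiff ℝ 1 fun y => f y • b y := hf1.smul hb1
  have hfd := hf1.continuous_fderiv one_ne_zero
  have hdiv := integral_divergence_eq_zero (d := d)
    (F := fun y => ψ (f y) • (∇ f y + f y • b y))
    (fun x i => by simp only [hf x i, hb x i, hf.gradient x i])
    ((hψ.comp hf1).smul (hg.add hfb))
  have hpt : ∀ x, divergence (fun y => ψ (f y) • (∇ f y + f y • b y)) x =
      ψ (f x) * (Δ f x + divergence (fun y => f y • b y) x) -
        -(ψ' (f x) * (‖fderiv ℝ f x‖ ^ 2 + f x * fderiv ℝ f x (b x))) := fun x => by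
    have hfx := hf1.differentiable one_ne_zero x
    have hψx : HasFDerivAt (fun y => ψ (f y)) (ψ' (f x) • fderiv ℝ f x) x :=
      (hψ' (f x)).comp_hasFDerivAt x hfx.hasFDerivAt
    rw [divergence_smul hψx.differentiableAt
        ((hg.add hfb).differentiable one_ne_zero x), hψx.fderiv,
      divergence_add (hg.differentiable one_ne_zero x) (hfb.differentiable one_ne_zero x),
      divergence_gradient hf2]
    have h1 : fderiv ℝ f x (∇ f x) = ‖fderiv ℝ f x‖ ^ 2 := by
      rw [← norm_gradient, ← real_inner_self_eq_norm_sq, inner_gradient_left]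
    simp only [smul_apply, map_add, map_smul, smul_eq_mul, h1]
    ring
  simp only [hpt] at hdiv
  rw [integral_sub (integrable_torus ?_) (integrable_torus ?_), sub_eq_zero] at hdiv
  · exact hdiv
  · exact (hψ.continuous.comp hf1.continuous).mul hint
  · have h2 : Continuous fun x => fderiv ℝ f x (b x) := hfd.clm_apply hb1.continuous
    have h3 := hf1.continuous
    fun_prop

/-- The energy estimate for the Fokker–Planck operator. -/
lemma integral_bracket_energy_le {f : E d → ℝ} (hf : IsPeriodic f)
    (hf2 : ContDiff ℝ 2 f) {b : E d → E d} (hb : IsPeriodic b) (hb1 : ContDiff ℝ 1 b)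
    (hint : Continuous (fun x => Δ f x + divergence (fun y => f y • b y) x)) {γ : ℝ} (hγ : 1 < γ) :
    ∫ x, γ * f x * bracket (γ - 2) (f x) * (Δ f x + divergence (fun y => f y • b y) x)
        ∂torusMeasure d ≤
      -(2 * (γ - 1) / γ) *
        (∫ x, ‖fderiv ℝ (fun y => bracket (γ / 2) (f y)) x‖ ^ 2 ∂torusMeasure d) +
      γ ^ 2 / 2 * ∫ x, ‖b x‖ ^ 2 * bracket (γ / 2) (f x) ^ 2 ∂torusMeasure d := by
  have hf1 : ContDiff ℝ 1 f := hf2.of_le (by norm_num)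
  have hfc := hf1.continuous
  have hbc := hb1.continuous
  have hfd := hf1.continuous_fderiv one_ne_zero
  have hw1 : ContDiff ℝ 1 fun y => bracket (γ / 2) (f y) := (contDiff_bracket _).comp hf1
  have hwd := hw1.continuous_fderiv one_ne_zero
  rw [integral_mul_laplacian_add_divergence hf hf2 hb hb1 (ψ := fun s => γ * s * bracket (γ - 2) s)
    ((contDiff_const.mul contDiff_id).mul (contDiff_bracket _)) (hasDerivAt_mul_bracket γ)
    (by fun_prop) hint, ← integral_const_mul, ← integral_const_mul, ← integral_add
    (integrable_torus (by fun_prop)) (integrable_torus (by fun_prop))]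
  have h2 : Continuous fun x => fderiv ℝ f x (b x) := hfd.clm_apply hbc
  refine integral_mono (integrable_torus (by fun_prop)) (integrable_torus (by fun_prop)) fun x => ?_
  have hw : fderiv ℝ (fun y => bracket (γ / 2) (f y)) x
      = (γ / 2 * f x * bracket (γ / 2 - 2) (f x)) • fderiv ℝ f x :=
    ((hasDerivAt_bracket (γ / 2) (f x)).comp_hasFDerivAt x
      (hf1.differentiable one_ne_zero x).hasFDerivAt).fderiv
  have hB : |fderiv ℝ f x (b x)| ≤ ‖fderiv ℝ f x‖ * ‖b x‖ := (fderiv ℝ f x).le_opNorm (b x)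
  have := bracket_energy_pointwise hγ (f x) ‖fderiv ℝ f x‖ ‖b x‖ (fderiv ℝ f x (b x)) hB
  simpa only [hw, norm_smul, mul_pow, Real.norm_eq_abs, sq_abs] using this

end Energy

/-! ### The differential inequality -/

section DifferentialInequality

variable {d : ℕ}

/-- At a fixed time, the production of `∫ ⟨f⟩^{θβ}` is controlled by `∫ ⟨f⟩^β` and the drift: the
Sobolev term produced by diffusion absorbs the contribution of the drift. -/
lemma exists_production_le (hd : 2 < d) {p q θ β : ℝ} (hp : (d : ℝ) / 2 < p)
    (hpq : p⁻¹ + q⁻¹ = 1) (hθ : 1 < θ) (hβ : 1 ≤ β) :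
    ∃ C : ℝ, 0 < C ∧ ∀ (f : E d → ℝ) (b : E d → E d), IsPeriodic f → ContDiff ℝ 2 f →
      IsPeriodic b → ContDiff ℝ 1 b →
      Continuous (fun x => Δ f x + divergence (fun y => f y • b y) x) →
      ∫ x, θ * β * f x * bracket (θ * β - 2) (f x) *
          (Δ f x + divergence (fun y => f y • b y) x) ∂torusMeasure d ≤
        C * (∫ x, bracket β (f x) ∂torusMeasure d) ^ θ *
          (1 + ((∫ x, (‖b x‖ ^ 2) ^ p ∂torusMeasure d) ^ p⁻¹) ^ (1 / kappa d q θ)) := by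
  obtain ⟨C₀, hC₀, hsob⟩ := exists_sobolev_torus hd
  set γ := θ * β with hγdef
  have hγ : 1 < γ := by nlinarith
  have hγ0 : 0 < γ := by linarith
  have hc : 0 < 2 * (γ - 1) / γ := by have : 0 < γ - 1 := by linarith
                                      positivity
  set c := 2 * (γ - 1) / γ
  set k := kappa d q θ
  -- the constants with which each of the two lower-order terms takes half of the Sobolev term
  set μ₁ : ℝ := 1 / (2 * C₀)
  set μ₂ : ℝ := c / (2 * C₀ * (γ ^ 2 / 2))
  have hμ₁ : 0 < μ₁ := by positivity
  have hμ₂ : 0 < μ₂ := by positivity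
  refine ⟨c * μ₁ ^ (-((1 - k) / k)) + γ ^ 2 / 2 * μ₂ ^ (-((1 - k) / k)), by positivity,
    fun f b hf hf2 hb hb1 hint => ?_⟩
  have hf1 : ContDiff ℝ 1 f := hf2.of_le (by norm_num)
  have hbc := hb1.continuous
  have hw1 : ContDiff ℝ 1 fun y => bracket (γ / 2) (f y) := (contDiff_bracket _).comp hf1
  have hwpos : ∀ x, 0 < bracket (γ / 2) (f x) := fun x => bracket_pos _ _
  have hen := integral_bracket_energy_le hf hf2 hb hb1 hint hγ
  have hs := hsob (fun y => bracket (γ / 2) (f y)) (hf.comp _) hw1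
  have hA : ∀ x, bracket (γ / 2) (f x) ^ (2 / θ) = bracket β (f x) := fun x => by
    rw [bracket_rpow, hγdef]; congr 1; field_simp
  have h1 := integral_mul_sq_le hd hp hpq hθ (h := fun _ => 1) continuous_const
    (fun _ => zero_le_one) hw1.continuous hwpos hμ₁
  have h2 := integral_mul_sq_le hd hp hpq hθ (h := fun x => ‖b x‖ ^ 2) (by fun_prop)
    (fun _ => by positivity) hw1.continuous hwpos hμ₂
  simp only [hA, one_mul, Real.one_rpow, integral_const, probReal_univ, smul_eq_mul] at h1 h2
  change _ ≤ μ₁ * _ + μ₁ ^ (-((1 - k) / k)) * _ at h1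
  change _ ≤ μ₂ * _ + μ₂ ^ (-((1 - k) / k)) * _ at h2
  set A := (∫ x, bracket β (f x) ∂torusMeasure d) ^ θ
  set N := ((∫ x, (‖b x‖ ^ 2) ^ p ∂torusMeasure d) ^ p⁻¹) ^ (1 / k)
  set S := (∫ x, |bracket (γ / 2) (f x)| ^ (2 * d / (d - 2) : ℝ) ∂torusMeasure d) ^
    ((d - 2) / d : ℝ)
  set D := ∫ x, ‖fderiv ℝ (fun y => bracket (γ / 2) (f y)) x‖ ^ 2 ∂torusMeasure d
  set W := ∫ x, bracket (γ / 2) (f x) ^ 2 ∂torusMeasure d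
  set B := ∫ x, ‖b x‖ ^ 2 * bracket (γ / 2) (f x) ^ 2 ∂torusMeasure d
  have hA0 : 0 ≤ A := Real.rpow_nonneg (integral_nonneg fun x => (bracket_pos _ _).le) _
  have hN0 : 0 ≤ N := Real.rpow_nonneg (Real.rpow_nonneg (integral_nonneg fun x => by
    positivity) _) _
  set ν₁ := μ₁ ^ (-((1 - k) / k))
  set ν₂ := μ₂ ^ (-((1 - k) / k))
  have hν₁ : 0 < ν₁ := by positivity
  have hν₂ : 0 < ν₂ := by positivity
  have h3 : c * (S / C₀) ≤ c * (D + W) :=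
    mul_le_mul_of_nonneg_left (by rw [div_le_iff₀' hC₀]; exact hs) hc.le
  have h4 := mul_le_mul_of_nonneg_left h1 hc.le
  have h5 := mul_le_mul_of_nonneg_left h2 (show 0 ≤ γ ^ 2 / 2 by positivity)
  have e1 : c * (μ₁ * S) = c * (S / C₀) / 2 := by simp only [μ₁]; field_simp
  have e2 : γ ^ 2 / 2 * (μ₂ * S) = c * (S / C₀) / 2 := by simp only [μ₂]; field_simp
  have h6 : 0 ≤ c * ν₁ * A * N := by positivity
  have h7 : 0 ≤ γ ^ 2 / 2 * ν₂ * A := by positivity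
  have hen' : _ ≤ -c * D + γ ^ 2 / 2 * B := hen
  linarith

lemma IsClassical.continuous {T : ℝ} {m : ℝ → E d → ℝ} (hm : IsClassical T m) {t : ℝ}
    (ht : t ∈ Icc 0 T) : Continuous (m t) :=
  hm.cont.comp_continuous (f := fun x => (t, x)) (by fun_prop) fun x => ⟨ht, mem_univ x⟩

lemma IsClassical.continuousOn_integral_bracket {T : ℝ} {m : ℝ → E d → ℝ} (hm : IsClassical T m)
    (a : ℝ) : ContinuousOn (fun t => ∫ x, bracket a (m t x) ∂torusMeasure d) (Icc 0 T) :=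
  continuousOn_integral_torus (f := fun t x => bracket a (m t x))
    ((continuous_bracket a).comp_continuousOn hm.cont)

lemma IsClassical.hasDerivAt_integral_bracket {T : ℝ} {m : ℝ → E d → ℝ} (hm : IsClassical T m)
    (a : ℝ) {t : ℝ} (ht : t ∈ Ioo 0 T) :
    HasDerivAt (fun t => ∫ x, bracket a (m t x) ∂torusMeasure d)
      (∫ x, a * m t x * bracket (a - 2) (m t x) * deriv (fun s => m s x) t ∂torusMeasure d) t := by
  have hc : ContinuousOn (Function.uncurry m) (Ioo 0 T ×ˢ univ) :=
    hm.cont.mono (prod_mono Ioo_subset_Icc_self subset_rfl)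
  refine hasDerivAt_integral_torus ht (f := fun t x => bracket a (m t x))
    (f' := fun t x => a * m t x * bracket (a - 2) (m t x) * deriv (fun s => m s x) t)
    (fun s hs => (continuous_bracket a).comp (hm.continuous (Ioo_subset_Icc_self hs))) ?_
    fun s hs x => HasDerivAt.comp s (h₂ := bracket a) (hasDerivAt_bracket a (m s x))
      (hm.diff_time s hs x).hasDerivAt
  exact ((continuousOn_const.mul hc).mul
    ((continuous_bracket (a - 2)).comp_continuousOn hc)).mul hm.cont_time

/-- The gain of integrability: a bound for `∫ ⟨m⟩^β` that is uniform in time gives one for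
`∫ ⟨m⟩^{θβ}` in terms of the drift `b`. -/
lemma exists_integral_bracket_le (hd : 2 < d) {p q θ β : ℝ} (hp : (d : ℝ) / 2 < p)
    (hpq : p⁻¹ + q⁻¹ = 1) (hθ : 1 < θ) (hβ : 1 ≤ β) :
    ∃ C : ℝ, 0 < C ∧ ∀ (T : ℝ) (m : ℝ → E d → ℝ) (b : ℝ → E d → E d) (M : ℝ), 0 < T →
      IsClassical T m → (∀ t ∈ Ioo 0 T, IsPeriodic (b t)) → (∀ t ∈ Ioo 0 T, ContDiff ℝ 1 (b t)) →
      (∀ t ∈ Ioo 0 T, ∀ x, deriv (fun s => m s x) t =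
        Δ (m t) x + divergence (fun y => m t y • b t y) x) →
      (∀ t ∈ Icc 0 T, ∫ x, bracket β (m t x) ∂torusMeasure d ≤ M) →
      IntegrableOn (fun t => ((∫ x, (‖b t x‖ ^ 2) ^ p ∂torusMeasure d) ^ p⁻¹) ^ (1 / kappa d q θ))
        (Ioo 0 T) →
      ∀ τ ∈ Icc 0 T, ∫ x, bracket (θ * β) (m τ x) ∂torusMeasure d ≤
        ∫ x, bracket (θ * β) (m 0 x) ∂torusMeasure d + C * M ^ θ * (T + ∫ t in Ioo 0 T,
          ((∫ x, (‖b t x‖ ^ 2) ^ p ∂torusMeasure d) ^ p⁻¹) ^ (1 / kappa d q θ)) := by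
  obtain ⟨C, hC, hprod⟩ := exists_production_le (β := β) hd hp hpq hθ hβ
  refine ⟨C, hC, fun T m b M hT hm hbp hb1 hfp hM hN τ hτ => ?_⟩
  set N : ℝ → ℝ := fun t => ((∫ x, (‖b t x‖ ^ 2) ^ p ∂torusMeasure d) ^ p⁻¹) ^ (1 / kappa d q θ)
  have hN0 : ∀ t, 0 ≤ N t := fun t =>
    Real.rpow_nonneg (Real.rpow_nonneg (integral_nonneg fun x => by positivity) _) _
  have hpos : ∀ t, 0 ≤ ∫ x, bracket β (m t x) ∂torusMeasure d := fun t =>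
    integral_nonneg fun x => (bracket_pos _ _).le
  have hM0 : 0 ≤ M := (hpos 0).trans (hM 0 ⟨le_rfl, hT.le⟩)
  have hφ : IntegrableOn (fun t => C * M ^ θ * (1 + N t)) (Ioo 0 T) :=
    ((integrable_const (1 : ℝ)).add hN).const_mul _
  have hφ' : IntegrableOn (fun t => C * M ^ θ * (1 + N t)) (Icc 0 T) :=
    (integrableOn_Icc_iff_integrableOn_Ioo enorm_ne_top enorm_ne_top).2 hφ
  have hsub := intervalIntegral.sub_le_integral_of_hasDeriv_right_of_le hτ.1
    ((hm.continuousOn_integral_bracket (θ * β)).mono (Icc_subset_Icc_right hτ.2))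
    (fun t ht => (hm.hasDerivAt_integral_bracket (θ * β)
      ⟨ht.1, ht.2.trans_le hτ.2⟩).hasDerivWithinAt)
    (hφ'.mono_set (Icc_subset_Icc_right hτ.2)) (fun t ht => ?_)
  · have h1 : ∫ t in (0 : ℝ)..τ, C * M ^ θ * (1 + N t) ≤
        ∫ t in Ioo 0 T, C * M ^ θ * (1 + N t) := by
      rw [intervalIntegral.integral_of_le hτ.1, ← integral_Ioc_eq_integral_Ioo]
      refine setIntegral_mono_set (hφ'.mono_set Ioc_subset_Icc_self)
        (ae_of_all _ fun t => ?_) (Ioc_subset_Ioc_right hτ.2).eventuallyLE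
      have := hN0 t
      simp only [Pi.zero_apply]
      positivity
    have h2 : ∫ t in Ioo 0 T, C * M ^ θ * (1 + N t) = C * M ^ θ * (T + ∫ t in Ioo 0 T, N t) := by
      rw [integral_const_mul, integral_add (integrable_const _) hN]
      simp [hT.le]
    linarith
  · have ht' : t ∈ Ioo 0 T := ⟨ht.1, ht.2.trans_le hτ.2⟩
    have htI := Ioo_subset_Icc_self ht'
    have hint : Continuous fun x => Δ (m t) x + divergence (fun y => m t y • b t y) x := by
      simp only [← hfp t ht']
      exact hm.cont_time.comp_continuous (f := fun x => (t, x)) (by fun_prop)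
        fun x => ⟨ht', mem_univ x⟩
    have h := hprod (m t) (b t) (hm.periodic t htI) (hm.diff_space t ht') (hbp t ht') (hb1 t ht')
      hint
    simp only [hfp t ht']
    refine h.trans ?_
    have h3 := Real.rpow_le_rpow (hpos t) (hM t htI) (show 0 ≤ θ by linarith)
    exact mul_le_mul_of_nonneg_right (mul_le_mul_of_nonneg_left h3 hC.le)
      (add_nonneg zero_le_one (hN0 t))

end DifferentialInequality

/-! ### The drift of the mean-field game -/

section Drift

variable {d : ℕ} {T : ℝ} {H : E d → E d → ℝ} {u : ℝ → E d → ℝ}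

lemma IsHamiltonian.contDiff_DpH (hH : IsHamiltonian H) :
    ContDiff ℝ 1 fun z : E d × E d => DpH H z.1 z.2 := by
  have h : ContDiff ℝ 1 fun z : E d × E d => fderiv ℝ (H z.1) z.2 :=
    ContDiff.fderiv (m := 2) (f := fun z : E d × E d => H z.1)
      (contDiff_infty.1 (hH.smooth.comp (by fun_prop : ContDiff ℝ ∞
        fun w : (E d × E d) × E d => (w.1.1, w.2))) 2)
      contDiff_snd (by norm_num)
  exact (InnerProductSpace.toDual ℝ (E d)).symm.contDiff.comp h

lemma isPeriodic_drift (hH : IsHamiltonian H) (hu : IsClassical T u) {t : ℝ} (ht : t ∈ Ioo 0 T) :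
    IsPeriodic fun x => DpH H x (∇ (u t) x) := fun x i => by
  simp only [DpH, hH.periodic x i, (hu.periodic t (Ioo_subset_Icc_self ht)).gradient x i]

lemma contDiff_drift (hH : IsHamiltonian H) (hu : IsClassical T u) {t : ℝ} (ht : t ∈ Ioo 0 T) :
    ContDiff ℝ 1 fun x => DpH H x (∇ (u t) x) :=
  hH.contDiff_DpH.comp (contDiff_id.prodMk (contDiff_gradient (hu.diff_space t ht)))

lemma continuousOn_driftSq (hH : IsHamiltonian H) (hu : IsClassical T u) :
    ContinuousOn (Function.uncurry (driftSq H u)) (Ioo 0 T ×ˢ univ) := by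
  have hg : ContinuousOn (fun z : ℝ × E d => ∇ (u z.1) z.2) (Ioo 0 T ×ˢ univ) :=
    (InnerProductSpace.toDual ℝ (E d)).symm.continuous.comp_continuousOn hu.cont_D
  exact ((hH.contDiff_DpH.continuous.comp_continuousOn (continuousOn_snd.prodMk hg)).norm).pow 2

lemma eLpNorm_driftSq (hH : IsHamiltonian H) (hu : IsClassical T u) {p : ℝ} (hp : 0 < p) {t : ℝ}
    (ht : t ∈ Ioo 0 T) : eLpNorm (driftSq H u t) (ENNReal.ofReal p) (torusMeasure d) =
      ENNReal.ofReal ((∫ x, driftSq H u t x ^ p ∂torusMeasure d) ^ p⁻¹) := by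
  have hc : Continuous (driftSq H u t) := ((contDiff_drift hH hu ht).continuous.norm).pow 2
  have h0 : ∀ x, ‖driftSq H u t x‖ = driftSq H u t x := fun x =>
    Real.norm_of_nonneg (sq_nonneg _)
  rw [eLpNorm_torus hc hp]
  simp only [h0]

/-- When the mixed norm of the drift is finite, its power is given by a Bochner integral. -/
lemma integral_driftSq_of_mixedNorm_ne_top (hH : IsHamiltonian H) (hu : IsClassical T u) {p r : ℝ}
    (hp : 0 < p) (hr : 0 < r)
    (hX : mixedNorm (ENNReal.ofReal r) (ENNReal.ofReal p) T (driftSq H u) ≠ ⊤) :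
    IntegrableOn (fun t => ((∫ x, driftSq H u t x ^ p ∂torusMeasure d) ^ p⁻¹) ^ r) (Ioo 0 T) ∧
    ∫ t in Ioo 0 T, ((∫ x, driftSq H u t x ^ p ∂torusMeasure d) ^ p⁻¹) ^ r =
      (mixedNorm (ENNReal.ofReal r) (ENNReal.ofReal p) T (driftSq H u)).toReal ^ r := by
  set F : ℝ → ℝ := fun t => ((∫ x, driftSq H u t x ^ p ∂torusMeasure d) ^ p⁻¹) ^ r
  have hI0 : ∀ t, 0 ≤ (∫ x, driftSq H u t x ^ p ∂torusMeasure d) ^ p⁻¹ := fun t =>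
    Real.rpow_nonneg (integral_nonneg fun x => Real.rpow_nonneg (sq_nonneg _) _) _
  have hF0 : ∀ t, 0 ≤ F t := fun t => Real.rpow_nonneg (hI0 t) _
  have hmeas : AEStronglyMeasurable F (volume.restrict (Ioo 0 T)) := by
    have h1 : AEStronglyMeasurable (fun z : ℝ × E d => driftSq H u z.1 z.2 ^ p)
        ((volume.restrict (Ioo 0 T)).prod (torusMeasure d)) := by
      rw [torusMeasure, Measure.prod_restrict]
      refine ((ContinuousOn.rpow_const (continuousOn_driftSq hH hu) fun z _ => Or.inr hp.le).mono
        (prod_mono subset_rfl (subset_univ _))).aestronglyMeasurable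
        (measurableSet_Ioo.prod (measurableSet_cell d))
    have h2 := h1.integral_prod_right'
    exact ((h2.aemeasurable.pow_const _).pow_const _).aestronglyMeasurable
  have hpow : ∫⁻ t in Ioo 0 T, ENNReal.ofReal (F t) =
      mixedNorm (ENNReal.ofReal r) (ENNReal.ofReal p) T (driftSq H u) ^ r := by
    rw [mixedNorm, eLpNorm_eq_lintegral_rpow_enorm_toReal (by simpa using hr)
      ENNReal.ofReal_ne_top, ENNReal.toReal_ofReal hr.le, ← ENNReal.rpow_mul,
      one_div, inv_mul_cancel₀ hr.ne', ENNReal.rpow_one]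
    refine setLIntegral_congr_fun measurableSet_Ioo fun t ht => ?_
    simp only [enorm_eq_self]
    rw [eLpNorm_driftSq hH hu hp ht, ENNReal.ofReal_rpow_of_nonneg (hI0 t) hr.le]
  have hint : IntegrableOn F (Ioo 0 T) := by
    refine ⟨hmeas, ?_⟩
    rw [hasFiniteIntegral_iff_ofReal (ae_of_all _ hF0), hpow]
    exact ENNReal.rpow_lt_top_of_nonneg hr.le hX
  refine ⟨hint, ?_⟩
  rw [integral_eq_lintegral_of_nonneg_ae (ae_of_all _ hF0) hmeas, hpow, ENNReal.toReal_rpow]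

end Drift

/-! ### Iteration -/

section Iteration

variable {d : ℕ}

/-- The starting point of the iteration. The assumed bound holds for almost every time; it extends
to all times by continuity. -/
lemma integral_bracket_le_of_mixedNorm_le {T : ℝ} (hT : 0 < T) {β : ℝ} (hβ : 1 ≤ β) {K : ℝ≥0}
    {m : ℝ → E d → ℝ} (hm : IsClassical T m) (hK : mixedNorm ∞ (ENNReal.ofReal β) T m ≤ K) :
    ∀ τ ∈ Icc 0 T, ∫ x, bracket β (m τ x) ∂torusMeasure d ≤ 2 ^ β * (1 + K ^ β) := by
  have hβ0 : 0 < β := by linarith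
  set F : ℝ → ℝ := fun t => ∫ x, bracket β (m t x) ∂torusMeasure d
  set c : ℝ := 2 ^ β * (1 + K ^ β)
  have hF : ContinuousOn F (Icc 0 T) := hm.continuousOn_integral_bracket β
  have hae : ∀ᵐ t ∂(volume.restrict (Icc 0 T)), F t ≤ c := by
    rw [← Measure.restrict_congr_set Ioo_ae_eq_Icc]
    have h1 : ∀ᵐ t ∂(volume.restrict (Ioo 0 T)),
        eLpNorm (m t) (ENNReal.ofReal β) (torusMeasure d) ≤ K := by
      rw [mixedNorm, eLpNorm_exponent_top] at hK
      filter_upwards [enorm_ae_le_eLpNormEssSup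
        (fun t => eLpNorm (m t) (ENNReal.ofReal β) (torusMeasure d))
        (volume.restrict (Ioo 0 T))] with t ht
      exact ht.trans hK
    filter_upwards [h1, ae_restrict_mem measurableSet_Ioo] with t ht htI
    have hmt := hm.continuous (Ioo_subset_Icc_self htI)
    have hI0 : 0 ≤ ∫ x, ‖m t x‖ ^ β ∂torusMeasure d := integral_nonneg fun x => by positivity
    rw [eLpNorm_torus hmt hβ0, ENNReal.ofReal_le_iff_le_toReal ENNReal.coe_ne_top,
      ENNReal.coe_toReal, Real.rpow_inv_le_iff_of_pos hI0 K.coe_nonneg hβ0] at ht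
    have hc : Continuous fun x => |m t x| ^ β :=
      hmt.abs.rpow_const fun x => Or.inr hβ0.le
    calc F t ≤ ∫ x, 2 ^ β * (1 + |m t x| ^ β) ∂torusMeasure d :=
          integral_mono (integrable_torus (by fun_prop)) (integrable_torus (by fun_prop))
            fun x => bracket_le hβ0.le _
      _ = 2 ^ β * (1 + ∫ x, |m t x| ^ β ∂torusMeasure d) := by
          rw [integral_const_mul, integral_add (integrable_const _) (integrable_torus hc)]
          simp
      _ ≤ c := by
          refine mul_le_mul_of_nonneg_left (add_le_add le_rfl ?_) (by positivity)
          simpa using ht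
  have heq := Measure.eqOn_Icc_of_ae_eq (μ := volume) hT.ne (f := fun t => min (F t) c) (g := F)
    (hae.mono fun t ht => min_eq_left ht)
    ((continuous_id.min continuous_const).comp_continuousOn hF) hF
  exact fun τ hτ => min_eq_left_iff.1 (heq hτ)

/-- The iterated bound for the smoothed powers of `m`. For `n = 0` the drift does not enter, hence
its norm need not be finite. -/
lemma exists_integral_bracket_iterate_le (hd : 2 < d) {T : ℝ} (hT : 0 < T) (m₀ : E d → ℝ)
    {β₀ : ℝ} (hβ₀ : 1 ≤ β₀) {θ : ℝ} (hθ : 1 < θ) {p q : ℝ} (hp : (d : ℝ) / 2 < p)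
    (hpq : p⁻¹ + q⁻¹ = 1) {r : ℝ} (hr : r = 1 / kappa d q θ) (K : ℝ≥0) (n : ℕ) :
    ∃ C : ℝ, 0 ≤ C ∧ ∀ (H : E d → E d → ℝ) (g : ℝ → ℝ) (η : E d → ℝ) (ε : ℝ) (u m : ℝ → E d → ℝ),
      IsHamiltonian H → IsSolution T H g η ε m₀ u m →
      mixedNorm ∞ (ENNReal.ofReal β₀) T m ≤ K →
      (n ≠ 0 → mixedNorm (ENNReal.ofReal r) (ENNReal.ofReal p) T (driftSq H u) ≠ ⊤) →
      ∀ τ ∈ Icc 0 T, ∫ x, bracket (θ ^ n * β₀) (m τ x) ∂torusMeasure d ≤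
        C * (max 1 (mixedNorm (ENNReal.ofReal r) (ENNReal.ofReal p) T (driftSq H u)).toReal) ^
          (r * ((θ ^ n - 1) / (θ - 1))) := by
  have hp0 : 0 < p := by have := (exponents_pos hd hp hpq).1; linarith
  have hr0 : 0 < r := by rw [hr]; have := kappa_pos hd hp hpq hθ; positivity
  induction n with
  | zero =>
    refine ⟨2 ^ β₀ * (1 + K ^ β₀), by positivity, fun H g η ε u m _ hsol hK _ τ hτ => ?_⟩
    simpa using integral_bracket_le_of_mixedNorm_le hT hβ₀ hsol.classical_m hK τ hτ
  | succ n ih =>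
    obtain ⟨C, hC, ih⟩ := ih
    have hβ : 1 ≤ θ ^ n * β₀ := one_le_mul_of_one_le_of_one_le (one_le_pow₀ hθ.le) hβ₀
    obtain ⟨C', hC', hgain⟩ := exists_integral_bracket_le (β := θ ^ n * β₀) hd hp hpq hθ hβ
    set I₀ := ∫ x, bracket (θ * (θ ^ n * β₀)) (m₀ x) ∂torusMeasure d
    have hI₀ : 0 ≤ I₀ := integral_nonneg fun x => (bracket_pos _ _).le
    refine ⟨I₀ + C' * C ^ θ * (T + 1), by positivity, fun H g η ε u m hH hsol hK hX τ hτ => ?_⟩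
    have hX := hX n.succ_ne_zero
    have hu := hsol.classical_u
    obtain ⟨hint, hval⟩ := integral_driftSq_of_mixedNorm_ne_top hH hu hp0 hr0 hX
    set X := (mixedNorm (ENNReal.ofReal r) (ENNReal.ofReal p) T (driftSq H u)).toReal
    set Y := max 1 X
    have hY1 : 1 ≤ Y := le_max_left _ _
    have hY0 : 0 ≤ Y := by linarith
    set e := r * ((θ ^ n - 1) / (θ - 1))
    have hθ1 : 0 < θ - 1 := by linarith
    have he : r * ((θ ^ (n + 1) - 1) / (θ - 1)) = e * θ + r := by
      simp only [e]; field_simp; ring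
    have he0 : 0 ≤ e := by
      have : 0 ≤ θ ^ n - 1 := sub_nonneg.2 (one_le_pow₀ hθ.le)
      positivity
    have h := hgain T m (fun t x => DpH H x (∇ (u t) x)) (C * Y ^ e) hT hsol.classical_m
      (fun t ht => isPeriodic_drift hH hu ht) (fun t ht => contDiff_drift hH hu ht)
      (fun t ht x => by have := hsol.fokker_planck t ht x; linarith)
      (ih H g η ε u m hH hsol hK fun _ => hX) (by rw [← hr]; exact hint) τ hτ
    rw [← hr, hsol.initial] at h
    change _ ≤ I₀ + C' * (C * Y ^ e) ^ θ * (T + ∫ t in Ioo 0 T,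
      ((∫ x, driftSq H u t x ^ p ∂torusMeasure d) ^ p⁻¹) ^ r) at h
    rw [hval, Real.mul_rpow hC (by positivity), ← Real.rpow_mul hY0] at h
    rw [he, pow_succ', mul_assoc]
    have hX0 : 0 ≤ X := ENNReal.toReal_nonneg
    have h1 : T + X ^ r ≤ (T + 1) * Y ^ r := by
      have h2 : X ^ r ≤ Y ^ r := Real.rpow_le_rpow hX0 (le_max_right _ _) hr0.le
      have h3 : 1 ≤ Y ^ r := Real.one_le_rpow hY1 hr0.le
      nlinarith
    have h4 : 1 ≤ Y ^ (e * θ + r) := Real.one_le_rpow hY1 (by positivity)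
    calc _ ≤ _ := h
      _ ≤ I₀ * Y ^ (e * θ + r) + C' * (C ^ θ * Y ^ (e * θ)) * ((T + 1) * Y ^ r) :=
          add_le_add (le_mul_of_one_le_right hI₀ h4)
            (mul_le_mul_of_nonneg_left h1 (by positivity))
      _ = (I₀ + C' * C ^ θ * (T + 1)) * Y ^ (e * θ + r) := by
          rw [Real.rpow_add (by linarith)]; ring

end Iteration

end MFG

/-- The constant `C` is chosen before the data `H`, `g`, `η` and before `ε`, `u`, `m`. The case
`r_n = 0` (for `n = 0`) follows the convention `a ^ 0 = 1` for all `a` in `[0,∞]`. -/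
theorem theorem1p2 (d : ℕ) (hd : 2 < d) (T : ℝ) (hT : 0 < T)
    (m₀ : MFG.E d → ℝ) (hm₀ : MFG.IsInitialDensity m₀)
    (β₀ : ℝ) (hβ₀ : 1 ≤ β₀) (θ : ℝ) (hθ : 1 < θ)
    (p q : ℝ) (hp : (d : ℝ) / 2 < p) (hpq : p⁻¹ + q⁻¹ = 1)
    (r : ℝ) (hr : r = 1 / MFG.kappa d q θ)
    (K : ℝ≥0) (n : ℕ) :
    ∃ C : ℝ≥0, ∀ (H : MFG.E d → MFG.E d → ℝ) (g : ℝ → ℝ) (η : MFG.E d → ℝ) (ε : ℝ)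
      (u m : ℝ → MFG.E d → ℝ),
      MFG.IsHamiltonian H → MFG.IsCoupling g → MFG.IsMollifier η → 0 ≤ ε →
      MFG.IsSolution T H g η ε m₀ u m →
      MFG.mixedNorm ∞ (ENNReal.ofReal β₀) T m ≤ K →
      ∀ τ ∈ Icc 0 T,
        ∫⁻ x, ENNReal.ofReal (m τ x ^ (θ ^ n * β₀)) ∂(MFG.torusMeasure d) ≤
          C + C * MFG.mixedNorm (ENNReal.ofReal r) (ENNReal.ofReal p) T (MFG.driftSq H u) ^
            (r * ((θ ^ n - 1) / (θ - 1))) := by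
  obtain ⟨C, hC, hbound⟩ :=
    MFG.exists_integral_bracket_iterate_le hd hT m₀ hβ₀ hθ hp hpq hr K n
  have hr0 : 0 < r := by rw [hr]; have := MFG.kappa_pos hd hp hpq hθ; positivity
  have hθ1 : 0 < θ - 1 := by linarith
  -- adding `1` makes the constant positive, so that the bound is `∞` when the mixed norm is
  refine ⟨C.toNNReal + 1, fun H g η ε u m hH _ _ _ hsol hK τ hτ => ?_⟩
  set X := MFG.mixedNorm (ENNReal.ofReal r) (ENNReal.ofReal p) T (MFG.driftSq H u)
  set e := r * ((θ ^ n - 1) / (θ - 1))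
  have he0 : 0 ≤ e := by
    have : 0 ≤ θ ^ n - 1 := sub_nonneg.2 (one_le_pow₀ hθ.le)
    positivity
  by_cases hX : n ≠ 0 ∧ X = ⊤
  · have he : 0 < e := by
      have : 0 < θ ^ n - 1 := sub_pos.2 (one_lt_pow₀ hθ hX.1)
      positivity
    rw [hX.2, ENNReal.top_rpow_of_pos he, ENNReal.mul_top (by simp)]
    simp
  · have h := hbound H g η ε u m hH hsol hK (fun hn hXt => hX ⟨hn, hXt⟩) τ hτ
    have ha : 0 ≤ θ ^ n * β₀ := by positivity
    have hcont := hsol.classical_m.continuous hτ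
    have hmax : max 1 X.toReal ^ e ≤ 1 + X.toReal ^ e := by
      have : 0 ≤ X.toReal ^ e := by positivity
      rcases max_cases 1 X.toReal with h | h <;> rw [h.1]
      · rw [Real.one_rpow]; linarith
      · linarith
    calc ∫⁻ x, ENNReal.ofReal (m τ x ^ (θ ^ n * β₀)) ∂(MFG.torusMeasure d)
        ≤ ∫⁻ x, ENNReal.ofReal (MFG.bracket (θ ^ n * β₀) (m τ x)) ∂(MFG.torusMeasure d) :=
          lintegral_mono fun x => ENNReal.ofReal_le_ofReal <|
            ((le_abs_self _).trans (Real.abs_rpow_le_abs_rpow _ _)).trans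
              (MFG.rpow_abs_le_bracket ha _)
      _ = ENNReal.ofReal (∫ x, MFG.bracket (θ ^ n * β₀) (m τ x) ∂(MFG.torusMeasure d)) :=
          (ofReal_integral_eq_lintegral_ofReal (MFG.integrable_torus (by fun_prop))
            (Filter.Eventually.of_forall fun x => (MFG.bracket_pos _ _).le)).symm
      _ ≤ ENNReal.ofReal (C + C * X.toReal ^ e) := ENNReal.ofReal_le_ofReal <| by
          refine h.trans ((mul_le_mul_of_nonneg_left hmax hC).trans (le_of_eq (by ring)))
      _ = ENNReal.ofReal C + ENNReal.ofReal C * ENNReal.ofReal (X ^ e).toReal := by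
          rw [ENNReal.ofReal_add hC (by positivity), ENNReal.ofReal_mul hC, ENNReal.toReal_rpow]
      _ ≤ _ := by
          have hle : ENNReal.ofReal C ≤ ((C.toNNReal + 1 : ℝ≥0) : ℝ≥0∞) := by
            rw [ENNReal.ofReal]; exact_mod_cast le_self_add
          exact add_le_add hle (mul_le_mul' hle ENNReal.ofReal_toReal_le)
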